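/- For $\delta>0$ let $\mathcal L_\delta u(x)=\int_{|y-x|<\delta}[u(y)-u(x)]\,\frac{3}{\delta^3}\,dy$, and consider the nonlocal problem $$-\mathcal L_\delta u=f\ \text{ in }(0,1),\qquad u=g\ \text{ on }[-\delta,0]\cup[1,1+\delta].$$ Let $N\ge 0$ be an integer, $h=\frac1{N+1}$, and $x_i=ih$ for integers and half-integers $i$. Put $r=\lfloor\delta/h\rfloor$ if $\delta\ge h$ and $r=1$ if $\delta<h$, and let $\widetilde\delta=rh$, $\eta=\frac{h}{2\widetilde\delta^{3}}$. Call $\delta$ a grid point if it is an integer multiple of $h$. Let $a_0=2-12r$, $a_m=2$ $(1\le m\le r-1)$, $a_r=1$, $a_{m+\frac12}=4$ $(0\le m\le r-1)$, and $a_s=0$ for $s>r$. The shifted-symmetric piecewise-quadratic collocation scheme for the unknowns $U=(u_1,\dots,u_N,u_{\frac12},u_{\frac32},\dots,u_{N+\frac12})$ is the linear system $A^SU=F^S$ with $$A^S=\eta\begin{pmatrix}\mathcal A&\mathcal B\\ \mathcal B^{\mathsf T}&\widetilde{\mathcal A}\end{pmatrix},\qquad (A^S)_{ij}=-\eta\,a_{|i-j|},\qquad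 F^S_i=f(x_i)+\eta\sum_{j}a_{|i-j|}\,g(x_j),$$ where $i$ (and, in $A^S$, also $j$) runs over $1,\dots,N,\frac12,\dots,N+\frac12$, and the sum runs over the boundary indices $j=-r+\frac12,-r+1,\dots,0$ and $j=N+1,N+\frac32,\dots,N+r+\frac12$. **Theorem.** Let $\beta\ge0$, $c_1,c_2>0$ and $M\in\mathbb R$. There is a constant $C>0$, depending only on $\beta,c_1,c_2,M$, such that the following holds for all $N\ge 0$ and all $\delta$ with $c_1h^\beta\le\delta\le c_2h^\beta$. The matrix $A^S$ is nonsingular. Moreover, put $R=\max\{\delta,h/2\}$ and let $u$ be a solution of the nonlocal problem that is $C^4$ on $[-R,1+R]$ with $|u^{(4)}|\le M$ there; if $\delta<h/2$, assume also that $u=g$ on $[-h/2,0]\cup[1,1+h/2]$ (the scheme then uses $g$ at $-h/2$ and $1+h/2$). Then the solution $U$ of $A^SU=F^S$ satisfies $$\max_{i}|u_i-u(x_i)|\le\begin{cases}C\,h^{\min\{2,1+\beta\}}&\text{if }\delta\text{ is not a grid point},\\ C\,h^{\max\{2,4-2\beta\}}&\text{if }\delta\text{ is a grid point},\end{cases}$$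 the maximum being over $i=\frac12,1,\dots,N,N+\frac12$. -/

import Mathlib

open MeasureTheory

noncomputable section

namespace NonlocalCollocation

/-! ### The continuous problem on `Ω = (0, 1)` -/

/-- The constant interaction kernel `γ_δ(z) = 3 / δ³`. -/
def kernel (δ : ℝ) (_z : ℝ) : ℝ := 3 / δ ^ 3

/-- The nonlocal operator `𝓛_δ u(x) = ∫_{B_δ(x)} (u(y) - u(x)) γ_δ(|y - x|) dy`. -/
def nonlocalOp (δ : ℝ) (u : ℝ → ℝ) (x : ℝ) : ℝ :=
  ∫ y in Metric.ball x δ, (u y - u x) * kernel δ |y - x|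

/-- The volumetric constraint domain `[-δ, 0] ∪ [1, 1 + δ]`. -/
def constraintDomain (δ : ℝ) : Set ℝ := Set.Icc (-δ) 0 ∪ Set.Icc 1 (1 + δ)

/-- `u` solves `-𝓛_δ u = f` in `Ω = (0, 1)` and `u = g` on `[-δ, 0] ∪ [1, 1 + δ]`. -/
structure SolvesNonlocal (δ : ℝ) (f g u : ℝ → ℝ) : Prop where
  equation : ∀ x ∈ Set.Ioo (0 : ℝ) 1, -nonlocalOp δ u x = f x
  constraint : ∀ x ∈ constraintDomain δ, u x = g x

/-! ### The mesh -/

/-- The mesh size `h = 1 / (N + 1)`. -/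
def meshSize (N : ℕ) : ℝ := 1 / ((N : ℝ) + 1)

/-- The mesh point `x_{k/2} = (k / 2) h`. Integer and half-integer mesh points are both indexed
by twice their subscript. -/
def node (N : ℕ) (k : ℤ) : ℝ := (k : ℝ) / 2 * meshSize N

/-- The ratio `r`: it is `⌊δ / h⌋` if `δ ≥ h`, and `1` if `δ ≤ h`. -/
def ratio (N : ℕ) (δ : ℝ) : ℕ := if meshSize N ≤ δ then ⌊δ / meshSize N⌋₊ else 1

/-- The mesh horizon `δ̃ = r h`. -/
def meshHorizon (N : ℕ) (δ : ℝ) : ℝ := (ratio N δ : ℝ) * meshSize N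

/-- `δ` is a grid point: an integer multiple of `h`. -/
def IsGridPoint (N : ℕ) (δ : ℝ) : Prop := ∃ n : ℕ, δ = (n : ℝ) * meshSize N

/-- The interior unknowns, in the order `x_1, …, x_N, x_{1/2}, x_{3/2}, …, x_{N+1/2}`. -/
abbrev Interior (N : ℕ) : Type := Fin N ⊕ Fin (N + 1)

/-- Twice the subscript of an interior mesh point. -/
def twiceIndex (N : ℕ) : Interior N → ℤ
  | Sum.inl i => 2 * ((i : ℤ) + 1)
  | Sum.inr i => 2 * (i : ℤ) + 1

/-- Twice the subscripts of the boundary points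
`x_{-r+1/2}, …, x_0` and `x_{N+1}, …, x_{N+r+1/2}`. -/
def boundaryIndices (N r : ℕ) : Finset ℤ :=
  Finset.Icc (-2 * (r : ℤ) + 1) 0 ∪ Finset.Icc (2 * (N : ℤ) + 2) (2 * (N : ℤ) + 2 * (r : ℤ) + 1)

/-! ### The shifted-symmetric scheme -/

/-- The coefficients, `coeff r k` being `a_{k/2}`: `a_0 = 2 - 12 r`, `a_m = 2` for `1 ≤ m ≤ r - 1`,
`a_r = 1`, `a_{m+1/2} = 4` for `0 ≤ m ≤ r - 1`, and zero beyond `a_r`. -/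
def coeff (r k : ℕ) : ℝ :=
  if 2 * r < k then 0
  else if k = 0 then 2 - 12 * (r : ℝ)
  else if k = 2 * r then 1
  else if Odd k then 4
  else 2

/-- The scaling `η = h / (2 δ̃³)`. -/
def eta (N : ℕ) (δ : ℝ) : ℝ := meshSize N / (2 * meshHorizon N δ ^ 3)

/-- The diagonal Toeplitz blocks `-toeplitz(a_0, a_1, …, a_r, 0, …, 0)`, of size `n × n`. -/
def diagBlock (r n : ℕ) : Matrix (Fin n) (Fin n) ℝ :=
  Matrix.of fun i j => -coeff r (2 * ((i : ℤ) - (j : ℤ))).natAbs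

/-- The off-diagonal `N × (N + 1)` Toeplitz block, with first column `-(a_{1/2}, a_{3/2}, …)`
and first row `-(a_{1/2}, a_{1/2}, a_{3/2}, …)`. -/
def offBlock (r N : ℕ) : Matrix (Fin N) (Fin (N + 1)) ℝ :=
  Matrix.of fun i j => -coeff r (2 * ((i : ℤ) - (j : ℤ)) + 1).natAbs

/-- The stiffness matrix `A^S`. -/
def stiffness (N : ℕ) (δ : ℝ) : Matrix (Interior N) (Interior N) ℝ :=
  eta N δ • Matrix.fromBlocks (diagBlock (ratio N δ) N) (offBlock (ratio N δ) N)
    (offBlock (ratio N δ) N).transpose (diagBlock (ratio N δ) (N + 1))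

/-- The right-hand side: the values of `f` at the interior mesh points plus the terms of the
stencil that multiply the prescribed boundary values `g(x_k)`. -/
def rhs (N : ℕ) (δ : ℝ) (f g : ℝ → ℝ) : Interior N → ℝ := fun p =>
  f (node N (twiceIndex N p)) +
    eta N δ * ∑ k ∈ boundaryIndices N (ratio N δ),
      coeff (ratio N δ) (twiceIndex N p - k).natAbs * g (node N k)

end NonlocalCollocation

end

open NonlocalCollocation

namespace NonlocalCollocation

/-! ### A comparison principle for matrices with nonpositive off-diagonal entries -/

/-! The argument is consistency plus stability, with every constant independent of `N` and `δ`.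

Stability: `A^S` has nonpositive off-diagonal entries. The stencil is a composite Simpson rule
centred at each node, hence exact on cubics, so it maps the concave quadratic `barrier` to `-1`
(`discreteOp_barrier`). The barrier is positive at all nodes involved, so `A^S` maps it to a vector
with entries at least `1`. The comparison principle then bounds the inverse in the maximum norm by
the maximum of the barrier, which gives nonsingularity as well (`abs_le_of_abs_stiffness_mulVec_le`,
`isUnit_det_stiffness`).

Consistency: `A^S` applied to the error is the truncation error (`stiffness_mulVec_error`). For `δ ≥
h` it consists of a horizon error `O((δ - δ̃) δ)` (`abs_nonlocalOp_sub_nonlocalOp_le`) and a Simpson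
error `O(h⁴ / δ²)` (`abs_nonlocalOp_sub_discreteOp_le`). The horizon error vanishes at grid points.
For `δ < h` both operators are within `O(h²)` of the second derivative. -/

theorem nonneg_of_mulVec_nonneg {ι : Type*} [Fintype ι] {A : Matrix ι ι ℝ} {b w : ι → ℝ}
    (hA : ∀ p q, p ≠ q → A p q ≤ 0) (hb : ∀ p, 0 < b p) (hAb : ∀ p, 0 < A.mulVec b p)
    (hw : ∀ p, 0 ≤ A.mulVec w p) (p : ι) : 0 ≤ w p := by
  classical
  have : Nonempty ι := ⟨p⟩
  -- Minimum principle for the quotient `w / b`: if its minimum `t` were negative, `w - t b` would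
  -- be nonnegative with a zero at `p₀`.
  obtain ⟨p₀, hp₀⟩ := Finite.exists_min fun q => w q / b q
  by_contra! hp
  set t := w p₀ / b p₀ with ht
  have ht0 : t < 0 := (hp₀ p).trans_lt (div_neg_of_neg_of_pos hp (hb p))
  have hnn : ∀ q, 0 ≤ w q - t * b q := fun q => by
    have := hp₀ q
    rw [le_div_iff₀ (hb q)] at this
    linarith
  have hz : w p₀ - t * b p₀ = 0 := by
    rw [ht, div_mul_cancel₀ _ (hb p₀).ne', sub_self]
  -- The diagonal term vanishes and the others are nonpositive. Yet `A w - t A b > 0` at `p₀`,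
  -- because `t < 0`.
  have h1 : A.mulVec (w - t • b) p₀ ≤ 0 := by
    refine Finset.sum_nonpos fun q _ => ?_
    by_cases hq : p₀ = q
    · subst hq
      simp [hz]
    · exact mul_nonpos_of_nonpos_of_nonneg (hA _ _ hq) (by simpa using hnn q)
  rw [Matrix.mulVec_sub, Matrix.mulVec_smul] at h1
  have h2 := hw p₀
  have h3 := hAb p₀
  simp only [Pi.sub_apply, Pi.smul_apply, smul_eq_mul] at h1
  nlinarith

theorem abs_le_of_abs_mulVec_le {ι : Type*} [Fintype ι] {A : Matrix ι ι ℝ} {b e : ι → ℝ} {T : ℝ}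
    (hA : ∀ p q, p ≠ q → A p q ≤ 0) (hb : ∀ p, 0 < b p) (hAb : ∀ p, 1 ≤ A.mulVec b p)
    (hT : 0 ≤ T) (he : ∀ p, |A.mulVec e p| ≤ T) (p : ι) : |e p| ≤ T * b p := by
  have hAb' : ∀ p, 0 < A.mulVec b p := fun p => zero_lt_one.trans_le (hAb p)
  have h1 := nonneg_of_mulVec_nonneg (w := T • b - e) hA hb hAb' (fun q => by
    have h2 := (abs_le.1 (he q)).2
    have h3 := hAb q
    rw [Matrix.mulVec_sub, Matrix.mulVec_smul]
    simp only [Pi.sub_apply, Pi.smul_apply, smul_eq_mul]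
    nlinarith) p
  have h4 := nonneg_of_mulVec_nonneg (w := T • b + e) hA hb hAb' (fun q => by
    have h2 := (abs_le.1 (he q)).1
    have h3 := hAb q
    rw [Matrix.mulVec_add, Matrix.mulVec_smul]
    simp only [Pi.add_apply, Pi.smul_apply, smul_eq_mul]
    nlinarith) p
  simp only [Pi.add_apply, Pi.sub_apply, Pi.smul_apply, smul_eq_mul] at h1 h4
  exact abs_le.2 ⟨by linarith, by linarith⟩

/-! ### The stencil as a composite Simpson rule -/

theorem coeff_nonneg (r : ℕ) {k : ℕ} (hk : k ≠ 0) : 0 ≤ coeff r k := by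
  unfold coeff
  split_ifs <;> norm_num

theorem coeff_eq_zero {r k : ℕ} (hk : 2 * r < k) : coeff r k = 0 := by
  simp [coeff, hk]

theorem sum_range_two_mul (F : ℕ → ℝ) (r : ℕ) :
    ∑ i ∈ Finset.range (2 * r), F i = ∑ m ∈ Finset.range r, (F (2 * m) + F (2 * m + 1)) := by
  induction r with
  | zero => simp
  | succ r ih =>
    rw [Finset.sum_range_succ, ← ih, show 2 * (r + 1) = 2 * r + 1 + 1 by ring,
      Finset.sum_range_succ, Finset.sum_range_succ]
    ring

theorem sum_Icc_neg_self (F : ℤ → ℝ) (n : ℕ) :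
    ∑ j ∈ Finset.Icc (-(n : ℤ)) n, F j =
      F 0 + ∑ i ∈ Finset.range n, (F ((i : ℤ) + 1) + F (-((i : ℤ) + 1))) := by
  induction n with
  | zero => simp
  | succ n ih =>
    have h : Finset.Icc (-((n + 1 : ℕ) : ℤ)) ((n + 1 : ℕ) : ℤ) =
        insert ((n : ℤ) + 1) (insert (-((n : ℤ) + 1)) (Finset.Icc (-(n : ℤ)) n)) := by
      ext j
      simp only [Finset.mem_Icc, Finset.mem_insert]
      push_cast
      omega
    rw [h, Finset.sum_insert, Finset.sum_insert, ih, Finset.sum_range_succ]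
    · ring
    · simp
    · simp only [Finset.mem_insert, Finset.mem_Icc]
      omega

/-- Six times the composite Simpson sum of `v` over `r` double steps on either side of `k`. -/
noncomputable def simpsonSum (r : ℕ) (v : ℤ → ℝ) (k : ℤ) : ℝ :=
  ∑ m ∈ Finset.range r,
    ((v (k + 2 * m) + 4 * v (k + 2 * m + 1) + v (k + 2 * m + 2)) +
      (v (k - 2 * m) + 4 * v (k - 2 * m - 1) + v (k - 2 * m - 2)))

/-- One side of the stencil. An even node between two Simpson panels collects weight `1 + 1 = 2`,
while the far end belongs to one panel only. The `G 0` terms account for the centre, where the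
panels of the other side also meet. -/
theorem sum_coeff_succ (r : ℕ) (G : ℕ → ℝ) :
    ∑ i ∈ Finset.range (2 * (r + 1)), coeff (r + 1) (i + 1) * G (i + 1) + 2 * G 0 =
      ∑ m ∈ Finset.range (r + 1), (G (2 * m) + 4 * G (2 * m + 1) + G (2 * m + 2)) + G 0 := by
  have hodd : ∀ m ∈ Finset.range (r + 1), coeff (r + 1) (2 * m + 1) = 4 := by
    intro m hm
    rw [Finset.mem_range] at hm
    have : Odd (2 * m + 1) := ⟨m, rfl⟩
    rw [coeff, if_neg (by omega), if_neg (by omega), if_neg (by omega), if_pos this]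
  have heven : ∀ m ∈ Finset.range r, coeff (r + 1) (2 * m + 1 + 1) = 2 := by
    intro m hm
    rw [Finset.mem_range] at hm
    have : ¬ Odd (2 * m + 1 + 1) := by rw [Nat.not_odd_iff_even]; exact ⟨m + 1, by ring⟩
    rw [coeff, if_neg (by omega), if_neg (by omega), if_neg (by omega), if_neg this]
  have hlast : coeff (r + 1) (2 * r + 1 + 1) = 1 := by
    rw [coeff, if_neg (by omega), if_neg (by omega), if_pos (by omega)]
  have htel : ∑ m ∈ Finset.range r, (G (2 * m + 2) - G (2 * m)) = G (2 * r) - G 0 := by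
    simpa [mul_add] using Finset.sum_range_sub (fun m => G (2 * m)) r
  rw [sum_range_two_mul, Finset.sum_congr rfl fun m hm => by rw [hodd m hm],
    Finset.sum_range_succ, hlast, Finset.sum_congr rfl fun m hm => by rw [heven m hm],
    Finset.sum_range_succ]
  have hsum : ∑ m ∈ Finset.range r, (4 * G (2 * m + 1) + 2 * G (2 * m + 1 + 1)) =
      ∑ m ∈ Finset.range r, (G (2 * m) + 4 * G (2 * m + 1) + G (2 * m + 2)) +
        ∑ m ∈ Finset.range r, (G (2 * m + 2) - G (2 * m)) := by
    rw [← Finset.sum_add_distrib]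
    exact Finset.sum_congr rfl fun m _ => by ring
  rw [hsum, htel]
  ring

/-- In `a_0 = 2 - 12 r`, the `2` is the Simpson weight of the centre, shared by both sides, and `12
r` is the total of all Simpson weights. -/
theorem sum_coeff_eq_simpsonSum {r : ℕ} (hr : 1 ≤ r) (v : ℤ → ℝ) (k : ℤ) :
    ∑ j ∈ Finset.Icc (-((2 * r : ℕ) : ℤ)) ((2 * r : ℕ) : ℤ), coeff r j.natAbs * v (k + j) =
      simpsonSum r v k - 12 * r * v k := by
  obtain ⟨r, rfl⟩ := Nat.exists_eq_add_of_le' hr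
  rw [sum_Icc_neg_self, Finset.sum_add_distrib]
  have h0 : coeff (r + 1) 0 = 2 - 12 * ((r + 1 : ℕ) : ℝ) := by simp [coeff]
  have hp := sum_coeff_succ r fun i => v (k + i)
  have hm := sum_coeff_succ r fun i => v (k - i)
  have ep : ∀ i : ℕ, ((i : ℤ) + 1).natAbs = i + 1 := fun i => by omega
  have em : ∀ i : ℕ, (-((i : ℤ) + 1)).natAbs = i + 1 := fun i => by omega
  simp only [ep, em, Int.natAbs_zero, h0, add_zero, simpsonSum, Finset.sum_add_distrib] at *
  push_cast at *
  simp only [sub_eq_add_neg, neg_add, add_assoc, add_zero, neg_zero] at *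
  linarith

/-- Exactness on cubics: odd powers cancel by symmetry. With unit node spacing a panel has length
`2`, so the square contributes three times the integral of `z²` over `[-2r, 2r]`, which is `16 r³`.
-/
theorem simpsonSum_cubic (r : ℕ) (c₀ c₁ c₂ c₃ : ℝ) (k : ℤ) :
    simpsonSum r (fun l => c₀ + c₁ * ((l : ℝ) - k) + c₂ * ((l : ℝ) - k) ^ 2 +
      c₃ * ((l : ℝ) - k) ^ 3) k = 12 * r * c₀ + 16 * (r : ℝ) ^ 3 * c₂ := by
  unfold simpsonSum
  induction r with
  | zero => simp
  | succ r ih =>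
    rw [Finset.sum_range_succ, ih]
    push_cast
    ring

/-- A grid function dominated by `B` has Simpson sum at most `12 r B`. -/
theorem abs_simpsonSum_le {r : ℕ} {v : ℤ → ℝ} {k : ℤ} {B : ℝ}
    (hv : ∀ l, k - 2 * r ≤ l → l ≤ k + 2 * r → |v l| ≤ B) :
    |simpsonSum r v k| ≤ 12 * r * B := by
  refine (Finset.abs_sum_le_sum_abs _ _).trans ?_
  have : ∀ m ∈ Finset.range r,
      |(v (k + 2 * m) + 4 * v (k + 2 * m + 1) + v (k + 2 * m + 2)) +
        (v (k - 2 * m) + 4 * v (k - 2 * m - 1) + v (k - 2 * m - 2))| ≤ 12 * B := by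
    intro m hm
    rw [Finset.mem_range] at hm
    have h1 := abs_le.1 (hv (k + 2 * m) (by omega) (by omega))
    have h2 := abs_le.1 (hv (k + 2 * m + 1) (by omega) (by omega))
    have h3 := abs_le.1 (hv (k + 2 * m + 2) (by omega) (by omega))
    have h4 := abs_le.1 (hv (k - 2 * m) (by omega) (by omega))
    have h5 := abs_le.1 (hv (k - 2 * m - 1) (by omega) (by omega))
    have h6 := abs_le.1 (hv (k - 2 * m - 2) (by omega) (by omega))
    exact abs_le.2 ⟨by linarith, by linarith⟩
  refine (Finset.sum_le_sum this).trans_eq ?_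
  simp
  ring

theorem simpsonSum_sub (r : ℕ) (v w : ℤ → ℝ) (k : ℤ) :
    simpsonSum r (fun l => v l - w l) k = simpsonSum r v k - simpsonSum r w k := by
  unfold simpsonSum
  rw [← Finset.sum_sub_distrib]
  exact Finset.sum_congr rfl fun m _ => by ring

/-! ### Cubic approximation -/

/-- Mean value inequality on the segment from `x` to `y`. It is iterated to obtain the Taylor
remainder; the factorial gain is given up. -/
theorem abs_le_mul_pow_succ_of_deriv {s : Set ℝ} (hs : Convex ℝ s) {w w' : ℝ → ℝ} {M x : ℝ}
    {n : ℕ} (hM : 0 ≤ M) (hx : x ∈ s) (hw : ∀ y ∈ s, HasDerivWithinAt w (w' y) s y)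
    (hw' : ∀ y ∈ s, |w' y| ≤ M * |y - x| ^ n) (hwx : w x = 0) {y : ℝ} (hy : y ∈ s) :
    |w y| ≤ M * |y - x| ^ (n + 1) := by
  have hsub : Set.uIcc x y ⊆ s := hs.ordConnected.uIcc_subset hx hy
  have h := (convex_uIcc x y).norm_image_sub_le_of_norm_hasDerivWithin_le (f := w) (f' := w')
    (C := M * |y - x| ^ n) (fun z hz => (hw z (hsub hz)).mono hsub)
    (fun z hz => (hw' z (hsub hz)).trans (by
      have : |z - x| ≤ |y - x| := by
        rw [abs_sub_comm z x, abs_sub_comm y x, abs_sub_comm x z]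
        have := Set.abs_sub_left_of_mem_uIcc hz
        rwa [abs_sub_comm x y]
      gcongr))
    Set.left_mem_uIcc Set.right_mem_uIcc
  rw [hwx, sub_zero, Real.norm_eq_abs, Real.norm_eq_abs, mul_assoc, ← pow_succ] at h
  exact h

/-- A cubic polynomial through `u x` approximates a `C⁴` function to fourth order at `x`. -/
theorem exists_cubic_approx {a b : ℝ} (hab : a < b) {u : ℝ → ℝ} {M : ℝ} (hM : 0 ≤ M)
    (hu : ContDiffOn ℝ 4 u (Set.Icc a b))
    (hu4 : ∀ y ∈ Set.Icc a b, |iteratedDerivWithin 4 u (Set.Icc a b) y| ≤ M)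
    {x : ℝ} (hx : x ∈ Set.Icc a b) :
    ∃ c₁ c₂ c₃ : ℝ, ∀ y ∈ Set.Icc a b,
      |u y - (u x + c₁ * (y - x) + c₂ * (y - x) ^ 2 + c₃ * (y - x) ^ 3)| ≤ M * |y - x| ^ 4 := by
  set I := Set.Icc a b with hI
  have hud : UniqueDiffOn ℝ I := uniqueDiffOn_Icc hab
  set D := fun n => iteratedDerivWithin n u I with hD
  have hder : ∀ n < 4, ∀ y ∈ I, HasDerivWithinAt (D n) (D (n + 1) y) I y := by
    intro n hn y hy
    have h := hu.differentiableOn_iteratedDerivWithin (m := n) (by exact_mod_cast hn) hud y hy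
    have h2 := h.hasDerivWithinAt
    simp only [hD]
    rwa [iteratedDerivWithin_succ]
  have h0 : D 0 = u := iteratedDerivWithin_zero
  have hconv : Convex ℝ I := convex_Icc a b
  have hid : ∀ y, HasDerivWithinAt (fun y : ℝ => y - x) 1 I y :=
    fun y => (hasDerivWithinAt_id y I).sub_const x
  -- Descent from the bound on `D 4`: each remainder below has the preceding one as its derivative
  -- and vanishes at `x`.
  have e3 : ∀ y ∈ I, |D 3 y - D 3 x| ≤ M * |y - x| ^ 1 := fun y hy =>
    abs_le_mul_pow_succ_of_deriv hconv (w := fun y => D 3 y - D 3 x) (w' := D 4) (n := 0) hM hx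
      (fun z hz => (hder 3 (by norm_num) z hz).sub_const _)
      (fun z hz => by simpa using hu4 z hz) (sub_self _) hy
  have e2 : ∀ y ∈ I, |D 2 y - (D 2 x + D 3 x * (y - x))| ≤ M * |y - x| ^ 2 := fun y hy =>
    abs_le_mul_pow_succ_of_deriv hconv (w := fun y => D 2 y - (D 2 x + D 3 x * (y - x)))
      (w' := fun y => D 3 y - D 3 x) hM hx
      (fun z hz => by
        exact ((hder 2 (by norm_num) z hz).sub
          (((hid z).const_mul (D 3 x)).const_add (D 2 x))).congr_deriv (by ring))
      e3 (by simp) hy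
  have e1 : ∀ y ∈ I, |D 1 y - (D 1 x + D 2 x * (y - x) + D 3 x / 2 * (y - x) ^ 2)| ≤
      M * |y - x| ^ 3 := fun y hy =>
    abs_le_mul_pow_succ_of_deriv hconv
      (w := fun y => D 1 y - (D 1 x + D 2 x * (y - x) + D 3 x / 2 * (y - x) ^ 2))
      (w' := fun y => D 2 y - (D 2 x + D 3 x * (y - x))) hM hx
      (fun z hz => by
        exact ((hder 1 (by norm_num) z hz).sub ((((hid z).const_mul (D 2 x)).const_add (D 1 x)).add
          (((hid z).pow 2).const_mul (D 3 x / 2)))).congr_deriv (by norm_num; ring))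
      e2 (by simp) hy
  refine ⟨D 1 x, D 2 x / 2, D 3 x / 6, fun y hy => ?_⟩
  rw [← h0]
  exact abs_le_mul_pow_succ_of_deriv hconv
      (w := fun y => D 0 y - (D 0 x + D 1 x * (y - x) + D 2 x / 2 * (y - x) ^ 2 +
        D 3 x / 6 * (y - x) ^ 3))
      (w' := fun y => D 1 y - (D 1 x + D 2 x * (y - x) + D 3 x / 2 * (y - x) ^ 2)) hM hx
      (fun z hz => by
        exact ((hder 0 (by norm_num) z hz).sub
          (((((hid z).const_mul (D 1 x)).const_add (D 0 x)).add
            (((hid z).pow 2).const_mul (D 2 x / 2))).add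
              (((hid z).pow 3).const_mul (D 3 x / 6)))).congr_deriv (by norm_num; ring))
      e1 (by simp) hy

/-! ### Quadrature -/

theorem integral_cubic (a b x c₀ c₁ c₂ c₃ : ℝ) :
    ∫ y in a..b, (c₀ + c₁ * (y - x) + c₂ * (y - x) ^ 2 + c₃ * (y - x) ^ 3) =
      (c₀ * (b - x) + c₁ * (b - x) ^ 2 / 2 + c₂ * (b - x) ^ 3 / 3 + c₃ * (b - x) ^ 4 / 4) -
      (c₀ * (a - x) + c₁ * (a - x) ^ 2 / 2 + c₂ * (a - x) ^ 3 / 3 + c₃ * (a - x) ^ 4 / 4) := by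
  refine intervalIntegral.integral_eq_sub_of_hasDerivAt
    (f := fun y => c₀ * (y - x) + c₁ * (y - x) ^ 2 / 2 + c₂ * (y - x) ^ 3 / 3 +
      c₃ * (y - x) ^ 4 / 4) (fun y _ => ?_) (Continuous.intervalIntegrable (by fun_prop) _ _)
  have hid : HasDerivAt (fun y : ℝ => y - x) 1 y := (hasDerivAt_id y).sub_const x
  exact ((((hid.const_mul c₀).add (((hid.pow 2).const_mul c₁).div_const 2)).add
    (((hid.pow 3).const_mul c₂).div_const 3)).add
      (((hid.pow 4).const_mul c₃).div_const 4)).congr_deriv (by norm_num; ring)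

theorem simpson_error {a b : ℝ} (hab : a < b) {u : ℝ → ℝ} {M : ℝ} (hM : 0 ≤ M)
    (hu : ContDiffOn ℝ 4 u (Set.Icc a b))
    (hu4 : ∀ y ∈ Set.Icc a b, |iteratedDerivWithin 4 u (Set.Icc a b) y| ≤ M)
    {x h : ℝ} (hh : 0 ≤ h) (hx : a ≤ x) (hxh : x + h ≤ b) :
    |(∫ y in x..(x + h), u y) - h / 6 * (u x + 4 * u (x + h / 2) + u (x + h))| ≤
      2 * M * h ^ 5 := by
  obtain ⟨c₁, c₂, c₃, hc⟩ := exists_cubic_approx hab hM hu hu4 (x := x) ⟨hx, by linarith⟩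
  set w := fun y => u y - (u x + c₁ * (y - x) + c₂ * (y - x) ^ 2 + c₃ * (y - x) ^ 3) with hw
  have hwB : ∀ y, x ≤ y → y ≤ x + h → |w y| ≤ M * h ^ 4 := fun y hy1 hy2 => by
    refine (hc y ⟨by linarith, by linarith⟩).trans ?_
    have : |y - x| ≤ h := abs_le.2 ⟨by linarith, by linarith⟩
    gcongr
  have hint : IntervalIntegrable u volume x (x + h) := by
    refine ContinuousOn.intervalIntegrable_of_Icc (by linarith) (hu.continuousOn.mono ?_)
    exact Set.Icc_subset_Icc hx hxh
  have h1 : |∫ y in x..(x + h), w y| ≤ M * h ^ 4 * h := by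
    have := intervalIntegral.norm_integral_le_of_norm_le_const (a := x) (b := x + h) (f := w)
      (C := M * h ^ 4) (fun y hy => by
        rw [Set.uIoc_of_le (by linarith)] at hy
        exact hwB y hy.1.le hy.2)
    rwa [add_sub_cancel_left, abs_of_nonneg hh] at this
  have h2 : ∫ y in x..(x + h), w y = (∫ y in x..(x + h), u y) -
      ∫ y in x..(x + h), (u x + c₁ * (y - x) + c₂ * (y - x) ^ 2 + c₃ * (y - x) ^ 3) :=
    intervalIntegral.integral_sub hint (Continuous.intervalIntegrable (by fun_prop) _ _)
  rw [integral_cubic] at h2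
  have h3 := abs_le.1 (hwB (x + h / 2) (by linarith) (by linarith))
  have h4 := abs_le.1 (hwB (x + h) (by linarith) (by linarith))
  -- Simpson's rule is exact on the cubic, so only the remainder `w` survives, and `w x = 0`.
  have h5 : (∫ y in x..(x + h), u y) - h / 6 * (u x + 4 * u (x + h / 2) + u (x + h)) =
      (∫ y in x..(x + h), w y) - h / 6 * (4 * w (x + h / 2) + w (x + h)) := by
    rw [h2]
    simp only [hw]
    ring
  have h6 : |4 * w (x + h / 2) + w (x + h)| ≤ 6 * (M * h ^ 4) := by
    have : 0 ≤ M * h ^ 4 := by positivity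
    exact abs_le.2 ⟨by linarith, by linarith⟩
  rw [h5]
  refine (abs_sub _ _).trans ?_
  rw [abs_mul, abs_of_nonneg (by positivity : 0 ≤ h / 6)]
  have h7 := mul_le_mul_of_nonneg_left h6 (by positivity : 0 ≤ h / 6)
  linarith

/-- Error of the composite Simpson rule on `[x - r h, x + r h]`. -/
theorem composite_simpson_error {a b : ℝ} (hab : a < b) {u : ℝ → ℝ} {M : ℝ} (hM : 0 ≤ M)
    (hu : ContDiffOn ℝ 4 u (Set.Icc a b))
    (hu4 : ∀ y ∈ Set.Icc a b, |iteratedDerivWithin 4 u (Set.Icc a b) y| ≤ M)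
    {h : ℝ} (hh : 0 ≤ h) (k : ℤ) (r : ℕ) (hx : a ≤ (k : ℝ) / 2 * h - r * h)
    (hx' : (k : ℝ) / 2 * h + r * h ≤ b) :
    |(∫ y in ((k : ℝ) / 2 * h - r * h)..((k : ℝ) / 2 * h + r * h), u y) -
      h / 6 * simpsonSum r (fun l => u ((l : ℝ) / 2 * h)) k| ≤ r * (4 * M * h ^ 5) := by
  have hint : ∀ c d, a ≤ c → c ≤ d → d ≤ b → IntervalIntegrable u volume c d :=
    fun c d h1 h2 h3 => ContinuousOn.intervalIntegrable_of_Icc h2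
      (hu.continuousOn.mono (Set.Icc_subset_Icc h1 h3))
  induction r with
  | zero => simp [simpsonSum]
  | succ r ih =>
    push_cast at hx hx' ⊢
    have hrh : 0 ≤ (r : ℝ) * h := by positivity
    set x := (k : ℝ) / 2 * h with hxdef
    have ih' := ih (by linarith) (by linarith)
    have hl := simpson_error hab hM hu hu4 hh (x := x - (r + 1) * h) (by linarith) (by linarith)
    have hr := simpson_error hab hM hu hu4 hh (x := x + r * h) (by linarith) (by linarith)
    have hsum : simpsonSum (r + 1) (fun l => u ((l : ℝ) / 2 * h)) k =
        simpsonSum r (fun l => u ((l : ℝ) / 2 * h)) k +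
        ((u (x + r * h) + 4 * u (x + r * h + h / 2) + u (x + r * h + h)) +
        (u (x - (r + 1) * h) + 4 * u (x - (r + 1) * h + h / 2) + u (x - (r + 1) * h + h))) := by
      simp only [simpsonSum, Finset.sum_range_succ]
      push_cast
      rw [show ((k : ℝ) + 2 * r) / 2 * h = x + r * h by ring,
        show ((k : ℝ) + 2 * r + 1) / 2 * h = x + r * h + h / 2 by ring,
        show ((k : ℝ) + 2 * r + 2) / 2 * h = x + r * h + h by ring,
        show ((k : ℝ) - 2 * r) / 2 * h = x - (r + 1) * h + h by ring,
        show ((k : ℝ) - 2 * r - 1) / 2 * h = x - (r + 1) * h + h / 2 by ring,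
        show ((k : ℝ) - 2 * r - 2) / 2 * h = x - (r + 1) * h by ring]
      ring
    have hsplit : (∫ y in (x - (r + 1) * h)..(x + (r + 1) * h), u y) =
        (∫ y in (x - (r + 1) * h)..(x - (r + 1) * h + h), u y) +
        (∫ y in (x - r * h)..(x + r * h), u y) +
        ∫ y in (x + r * h)..(x + r * h + h), u y := by
      rw [show x - (r + 1) * h + h = x - r * h by ring,
        show x + r * h + h = x + (r + 1) * h by ring,
        intervalIntegral.integral_add_adjacent_intervals,
        intervalIntegral.integral_add_adjacent_intervals] <;> apply hint <;> linarith
    rw [hsum, hsplit]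
    have h1 := abs_le.1 ih'
    have h2 := abs_le.1 hl
    have h3 := abs_le.1 hr
    exact abs_le.2 ⟨by linarith, by linarith⟩

/-! ### Consistency -/

theorem nonlocalOp_eq {δ : ℝ} (hδ : 0 < δ) (u : ℝ → ℝ) (x : ℝ) :
    nonlocalOp δ u x = 3 / δ ^ 3 * ∫ y in (x - δ)..(x + δ), (u y - u x) := by
  rw [nonlocalOp, Real.ball_eq_Ioo, intervalIntegral.integral_of_le (by linarith),
    integral_Ioc_eq_integral_Ioo, ← integral_const_mul]
  simp only [kernel, mul_comm]

/-- Symmetry removes the odd terms, and the kernel is normalised so that the quadratic term yields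
exactly `2 * c₂` for every horizon. -/
theorem nonlocalOp_eq_cubic_add {a b : ℝ} {u : ℝ → ℝ} (hu : ContinuousOn u (Set.Icc a b))
    {δ x : ℝ} (hδ : 0 < δ) (hx : a ≤ x - δ) (hx' : x + δ ≤ b) (c₁ c₂ c₃ : ℝ) :
    nonlocalOp δ u x = 2 * c₂ + 3 / δ ^ 3 * ∫ y in (x - δ)..(x + δ),
      (u y - (u x + c₁ * (y - x) + c₂ * (y - x) ^ 2 + c₃ * (y - x) ^ 3)) := by
  have hint : IntervalIntegrable u volume (x - δ) (x + δ) :=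
    ContinuousOn.intervalIntegrable_of_Icc (by linarith) (hu.mono (Set.Icc_subset_Icc hx hx'))
  rw [nonlocalOp_eq hδ, intervalIntegral.integral_sub hint (by simp),
    intervalIntegral.integral_sub hint (Continuous.intervalIntegrable (by fun_prop) _ _),
    integral_cubic, intervalIntegral.integral_const]
  simp only [smul_eq_mul]
  field_simp
  ring

theorem abs_nonlocalOp_sub_le {a b : ℝ} {u : ℝ → ℝ} (hu : ContinuousOn u (Set.Icc a b))
    {δ x M : ℝ} (hM : 0 ≤ M) (hδ : 0 < δ) (hx : a ≤ x - δ) (hx' : x + δ ≤ b) {c₁ c₂ c₃ : ℝ}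
    (hc : ∀ y ∈ Set.Icc a b, |u y - (u x + c₁ * (y - x) + c₂ * (y - x) ^ 2 + c₃ * (y - x) ^ 3)| ≤
      M * |y - x| ^ 4) :
    |nonlocalOp δ u x - 2 * c₂| ≤ 6 * M * δ ^ 2 := by
  rw [nonlocalOp_eq_cubic_add hu hδ hx hx' c₁ c₂ c₃, add_sub_cancel_left, abs_mul,
    abs_of_pos (by positivity)]
  have h := intervalIntegral.norm_integral_le_of_norm_le_const (a := x - δ) (b := x + δ)
    (f := fun y => u y - (u x + c₁ * (y - x) + c₂ * (y - x) ^ 2 + c₃ * (y - x) ^ 3))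
    (C := M * δ ^ 4) (fun y hy => by
      rw [Set.uIoc_of_le (by linarith)] at hy
      refine (hc y ⟨by linarith [hy.1], by linarith [hy.2]⟩).trans ?_
      have : |y - x| ≤ δ := abs_le.2 ⟨by linarith [hy.1], by linarith [hy.2]⟩
      gcongr)
  rw [Real.norm_eq_abs, show x + δ - (x - δ) = 2 * δ by ring, abs_of_pos (by positivity : 0 < 2 * δ)] at h
  refine (mul_le_mul_of_nonneg_left h (by positivity)).trans_eq ?_
  field_simp
  ring

/-- The two operators agree on cubics, so only the remainder counts. The thin shell between the two
balls contributes `6` and the changed normalisation `18` to the constant, each with the small factor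
`δ - ρ`. -/
theorem abs_nonlocalOp_sub_nonlocalOp_le {a b : ℝ} {u : ℝ → ℝ}
    (hu : ContinuousOn u (Set.Icc a b)) {ρ δ x M : ℝ} (hM : 0 ≤ M) (hρ : 0 < ρ) (hρδ : ρ ≤ δ)
    (hx : a ≤ x - δ) (hx' : x + δ ≤ b) {c₁ c₂ c₃ : ℝ}
    (hc : ∀ y ∈ Set.Icc a b, |u y - (u x + c₁ * (y - x) + c₂ * (y - x) ^ 2 + c₃ * (y - x) ^ 3)| ≤
      M * |y - x| ^ 4) :
    |nonlocalOp δ u x - nonlocalOp ρ u x| ≤ 24 * M * ((δ - ρ) * δ) := by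
  have hδ : 0 < δ := hρ.trans_le hρδ
  have hop := abs_nonlocalOp_sub_le hu hM hρ (by linarith) (by linarith) hc
  have e₁ := nonlocalOp_eq_cubic_add hu hδ hx hx' c₁ c₂ c₃
  have e₂ := nonlocalOp_eq_cubic_add hu hρ (by linarith : a ≤ x - ρ) (by linarith) c₁ c₂ c₃
  set w := fun y => u y - (u x + c₁ * (y - x) + c₂ * (y - x) ^ 2 + c₃ * (y - x) ^ 3) with hw
  have hwc : ContinuousOn w (Set.Icc a b) := hu.sub (Continuous.continuousOn (by fun_prop))
  have hint : ∀ c d, a ≤ c → c ≤ d → d ≤ b → IntervalIntegrable w volume c d :=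
    fun c d h1 h2 h3 => ContinuousOn.intervalIntegrable_of_Icc h2
      (hwc.mono (Set.Icc_subset_Icc h1 h3))
  have hB : ∀ c d, x - δ ≤ c → c ≤ d → d ≤ x + δ →
      |∫ y in c..d, w y| ≤ M * δ ^ 4 * (d - c) := by
    intro c d h1 h2 h3
    have h := intervalIntegral.norm_integral_le_of_norm_le_const (a := c) (b := d) (f := w)
      (C := M * δ ^ 4) (fun y hy => by
        rw [Set.uIoc_of_le h2] at hy
        refine (hc y ⟨by linarith [hy.1], by linarith [hy.2]⟩).trans ?_
        have : |y - x| ≤ δ := abs_le.2 ⟨by linarith [hy.1], by linarith [hy.2]⟩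
        gcongr)
    rwa [abs_of_nonneg (sub_nonneg.2 h2)] at h
  have hsplit : (∫ y in (x - δ)..(x + δ), w y) =
      (∫ y in (x - δ)..(x - ρ), w y) + (∫ y in (x - ρ)..(x + ρ), w y) +
        ∫ y in (x + ρ)..(x + δ), w y := by
    rw [intervalIntegral.integral_add_adjacent_intervals,
      intervalIntegral.integral_add_adjacent_intervals] <;> apply hint <;> linarith
  have hl := abs_le.1 (hB (x - δ) (x - ρ) (by linarith) (by linarith) (by linarith))
  have hr := abs_le.1 (hB (x + ρ) (x + δ) (by linarith) (by linarith) (by linarith))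
  set J := ∫ y in (x - ρ)..(x + ρ), w y with hJ
  set Jl := ∫ y in (x - δ)..(x - ρ), w y
  set Jr := ∫ y in (x + ρ)..(x + δ), w y
  have hJJ : |Jl + Jr| ≤ 2 * (M * δ ^ 4 * (δ - ρ)) := abs_le.2 ⟨by linarith, by linarith⟩
  have key : nonlocalOp δ u x - nonlocalOp ρ u x =
      3 / δ ^ 3 * (Jl + Jr) - (1 - ρ ^ 3 / δ ^ 3) * (nonlocalOp ρ u x - 2 * c₂) := by
    rw [e₁, e₂, hsplit]
    field_simp
    ring
  have hfac : |1 - ρ ^ 3 / δ ^ 3| ≤ 3 * (δ - ρ) / δ := by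
    have h1 : ρ ^ 3 ≤ δ ^ 3 := by gcongr
    rw [abs_of_nonneg (sub_nonneg.2 ((div_le_one (by positivity)).2 h1)),
      show 1 - ρ ^ 3 / δ ^ 3 = (δ - ρ) * (δ ^ 2 + δ * ρ + ρ ^ 2) / δ ^ 3 by field_simp; ring,
      div_le_div_iff₀ (by positivity) hδ]
    have h2 : δ ^ 2 + δ * ρ + ρ ^ 2 ≤ 3 * δ ^ 2 := by nlinarith
    have h3 := mul_le_mul_of_nonneg_left h2 (mul_nonneg (sub_nonneg.2 hρδ) hδ.le)
    linarith
  rw [key]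
  refine (abs_sub _ _).trans ?_
  rw [abs_mul, abs_mul, abs_of_pos (by positivity : 0 < 3 / δ ^ 3)]
  have h1 := mul_le_mul_of_nonneg_left hJJ (by positivity : 0 ≤ 3 / δ ^ 3)
  have hop' : |nonlocalOp ρ u x - 2 * c₂| ≤ 6 * M * δ ^ 2 := hop.trans (by gcongr)
  have h2 := mul_le_mul hfac hop' (abs_nonneg _)
    (div_nonneg (mul_nonneg (by norm_num) (sub_nonneg.2 hρδ)) hδ.le)
  refine (add_le_add h1 h2).trans_eq ?_
  field_simp
  ring

/-- The discrete operator `η ∑ a_{|i-j|} v_j`, at the mesh point `x_{k/2}`. -/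
noncomputable def discreteOp (h : ℝ) (r : ℕ) (v : ℤ → ℝ) (k : ℤ) : ℝ :=
  h / (2 * (r * h) ^ 3) * (simpsonSum r v k - 12 * r * v k)

/-- Serves the case `δ < h`, where the continuous and discrete operators are compared through their
common limit `2 * c₂`. -/
theorem abs_discreteOp_sub_le {a b : ℝ} {u : ℝ → ℝ} {h M : ℝ} (hM : 0 ≤ M) (hh : 0 < h)
    {r : ℕ} (hr : 1 ≤ r) {k : ℤ} (hx : a ≤ (k : ℝ) / 2 * h - r * h)
    (hx' : (k : ℝ) / 2 * h + r * h ≤ b) {c₁ c₂ c₃ : ℝ}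
    (hc : ∀ y ∈ Set.Icc a b, |u y - (u ((k : ℝ) / 2 * h) + c₁ * (y - (k : ℝ) / 2 * h) +
      c₂ * (y - (k : ℝ) / 2 * h) ^ 2 + c₃ * (y - (k : ℝ) / 2 * h) ^ 3)| ≤
      M * |y - (k : ℝ) / 2 * h| ^ 4) :
    |discreteOp h r (fun l => u ((l : ℝ) / 2 * h)) k - 2 * c₂| ≤ 6 * M * (r * h) ^ 2 := by
  have hr0 : (0 : ℝ) < r := by exact_mod_cast hr
  set x := (k : ℝ) / 2 * h with hxd
  have hB := abs_simpsonSum_le (r := r) (k := k) (B := M * (r * h) ^ 4)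
    (v := fun l : ℤ => u ((l : ℝ) / 2 * h) - (u x + c₁ * (h / 2) * ((l : ℝ) - k) +
      c₂ * (h / 2) ^ 2 * ((l : ℝ) - k) ^ 2 + c₃ * (h / 2) ^ 3 * ((l : ℝ) - k) ^ 3))
    (fun l hl hl' => by
      have h1 : ((k : ℝ) - 2 * r) ≤ l := by exact_mod_cast hl
      have h2 : (l : ℝ) ≤ k + 2 * r := by exact_mod_cast hl'
      have h3 := mul_le_mul_of_nonneg_right h1 hh.le
      have h4 := mul_le_mul_of_nonneg_right h2 hh.le
      have h5 := hc ((l : ℝ) / 2 * h) ⟨by linarith, by linarith⟩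
      rw [show (l : ℝ) / 2 * h - x = h / 2 * ((l : ℝ) - k) by rw [hxd]; ring] at h5
      have h6 : |h / 2 * ((l : ℝ) - k)| ≤ r * h := abs_le.2 ⟨by linarith, by linarith⟩
      have h7 : M * |h / 2 * ((l : ℝ) - k)| ^ 4 ≤ M * (r * h) ^ 4 := by gcongr
      refine le_trans (le_of_eq ?_) (h5.trans h7)
      congr 1
      ring)
  rw [simpsonSum_sub, simpsonSum_cubic] at hB
  rw [discreteOp]
  set S := simpsonSum r (fun l => u ((l : ℝ) / 2 * h)) k
  have : h / (2 * (r * h) ^ 3) * (S - 12 * r * u x) - 2 * c₂ = h / (2 * (r * h) ^ 3) *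
      (S - (12 * r * u x + 16 * (r : ℝ) ^ 3 * (c₂ * (h / 2) ^ 2))) := by
    field_simp
    ring
  rw [this, abs_mul, abs_of_pos (by positivity)]
  refine (mul_le_mul_of_nonneg_left hB (by positivity)).trans_eq ?_
  field_simp
  ring

theorem abs_nonlocalOp_sub_discreteOp_le {a b : ℝ} (hab : a < b) {u : ℝ → ℝ} {M : ℝ} (hM : 0 ≤ M)
    (hu : ContDiffOn ℝ 4 u (Set.Icc a b))
    (hu4 : ∀ y ∈ Set.Icc a b, |iteratedDerivWithin 4 u (Set.Icc a b) y| ≤ M)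
    {h : ℝ} (hh : 0 < h) {r : ℕ} (hr : 1 ≤ r) {k : ℤ} (hx : a ≤ (k : ℝ) / 2 * h - r * h)
    (hx' : (k : ℝ) / 2 * h + r * h ≤ b) :
    |nonlocalOp (r * h) u ((k : ℝ) / 2 * h) - discreteOp h r (fun l => u ((l : ℝ) / 2 * h)) k| ≤
      12 * M * h ^ 4 / (r * h) ^ 2 := by
  have hr0 : (0 : ℝ) < r := by exact_mod_cast hr
  have hint : IntervalIntegrable u volume ((k : ℝ) / 2 * h - r * h) ((k : ℝ) / 2 * h + r * h) :=
    ContinuousOn.intervalIntegrable_of_Icc (by nlinarith)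
      (hu.continuousOn.mono (Set.Icc_subset_Icc hx hx'))
  have hs := composite_simpson_error hab hM hu hu4 hh.le k r hx hx'
  rw [nonlocalOp_eq (by positivity), discreteOp, intervalIntegral.integral_sub hint (by simp),
    intervalIntegral.integral_const, smul_eq_mul]
  set x := (k : ℝ) / 2 * h with hxd
  set S := simpsonSum r (fun l => u ((l : ℝ) / 2 * h)) k
  set J := ∫ y in (x - r * h)..(x + r * h), u y
  -- The discrete operator is the continuous one of horizon `r h` with its integral replaced by
  -- Simpson's rule.
  have : 3 / (r * h) ^ 3 * (J - (x + r * h - (x - r * h)) * u x) -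
      h / (2 * (r * h) ^ 3) * (S - 12 * r * u x) = 3 / (r * h) ^ 3 * (J - h / 6 * S) := by
    field_simp
    ring
  rw [this, abs_mul, abs_of_pos (by positivity)]
  refine (mul_le_mul_of_nonneg_left hs (by positivity)).trans_eq ?_
  field_simp
  ring

/-! ### The linear system -/

theorem meshSize_pos (N : ℕ) : 0 < meshSize N := by
  unfold meshSize
  positivity

theorem meshSize_mul (N : ℕ) : ((N : ℝ) + 1) * meshSize N = 1 := by
  unfold meshSize
  field_simp

theorem meshSize_le_one (N : ℕ) : meshSize N ≤ 1 := by
  rw [← meshSize_mul N]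
  exact le_mul_of_one_le_left (meshSize_pos N).le (by simp)

theorem one_le_ratio (N : ℕ) (δ : ℝ) : 1 ≤ ratio N δ := by
  unfold ratio
  split_ifs with h
  · exact (Nat.one_le_floor_iff _).2 ((one_le_div (meshSize_pos N)).2 h)
  · exact le_rfl

theorem ratio_of_lt {N : ℕ} {δ : ℝ} (h : δ < meshSize N) : ratio N δ = 1 :=
  if_neg h.not_ge

theorem meshHorizon_le {N : ℕ} {δ : ℝ} (h : meshSize N ≤ δ) : ratio N δ * meshSize N ≤ δ := by
  rw [ratio, if_pos h, ← le_div_iff₀ (meshSize_pos N)]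
  exact Nat.floor_le (div_nonneg ((meshSize_pos N).le.trans h) (meshSize_pos N).le)

theorem lt_meshHorizon_add {N : ℕ} {δ : ℝ} (h : meshSize N ≤ δ) :
    δ < ratio N δ * meshSize N + meshSize N := by
  rw [ratio, if_pos h, ← add_one_mul, ← div_lt_iff₀ (meshSize_pos N)]
  exact Nat.lt_floor_add_one _

/-- Since `δ > 0`, the multiple is at least `1` and the floor loses nothing: the horizon error is
zero. -/
theorem IsGridPoint.meshHorizon_eq {N : ℕ} {δ : ℝ} (hg : IsGridPoint N δ) (hδ : 0 < δ) :
    meshSize N ≤ δ ∧ ratio N δ * meshSize N = δ := by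
  obtain ⟨n, rfl⟩ := hg
  have hh := meshSize_pos N
  have hn : 1 ≤ n := by
    rcases Nat.eq_zero_or_pos n with rfl | h
    · simp at hδ
    · exact h
  have hle : meshSize N ≤ n * meshSize N :=
    le_mul_of_one_le_left hh.le (by exact_mod_cast hn)
  refine ⟨hle, ?_⟩
  rw [ratio, if_pos hle, mul_div_assoc, div_self hh.ne', mul_one, Nat.floor_natCast]

theorem twiceIndex_mem {N : ℕ} (p : Interior N) :
    1 ≤ twiceIndex N p ∧ twiceIndex N p ≤ 2 * N + 1 := by
  rcases p with i | i <;> simp only [twiceIndex] <;> omega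

theorem twiceIndex_injective (N : ℕ) : Function.Injective (twiceIndex N) := by
  rintro (i | i) (j | j) h <;> simp only [twiceIndex] at h
  · rw [Fin.ext (by omega : (i : ℕ) = j)]
  · omega
  · omega
  · rw [Fin.ext (by omega : (i : ℕ) = j)]

theorem image_twiceIndex (N : ℕ) :
    Finset.univ.image (twiceIndex N) = Finset.Icc 1 (2 * (N : ℤ) + 1) := by
  refine Finset.eq_of_subset_of_card_le (fun k hk => ?_) ?_
  · obtain ⟨p, -, rfl⟩ := Finset.mem_image.1 hk
    exact Finset.mem_Icc.2 (twiceIndex_mem p)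
  · rw [Finset.card_image_of_injective _ (twiceIndex_injective N)]
    simp
    omega

theorem stiffness_apply (N : ℕ) (δ : ℝ) (p q : Interior N) :
    stiffness N δ p q =
      -(eta N δ * coeff (ratio N δ) (twiceIndex N p - twiceIndex N q).natAbs) := by
  rcases p with i | i <;> rcases q with j | j <;>
    simp only [stiffness, Matrix.smul_apply, Matrix.fromBlocks_apply₁₁, Matrix.fromBlocks_apply₁₂,
      Matrix.fromBlocks_apply₂₁, Matrix.fromBlocks_apply₂₂, diagBlock, offBlock, Matrix.of_apply,
      Matrix.transpose_apply, smul_eq_mul, mul_neg, twiceIndex] <;> congr 3 <;> omega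

/-- Every point within reach of an interior node is an unknown or a boundary index, and boundary
indices out of reach have coefficient zero. -/
theorem sum_interior_add_sum_boundary {N r : ℕ} (hr : 1 ≤ r) (v : ℤ → ℝ) (p : Interior N) :
    ∑ q, coeff r (twiceIndex N p - twiceIndex N q).natAbs * v (twiceIndex N q) +
      ∑ k ∈ boundaryIndices N r, coeff r (twiceIndex N p - k).natAbs * v k =
      simpsonSum r v (twiceIndex N p) - 12 * r * v (twiceIndex N p) := by
  obtain ⟨ht, ht'⟩ := twiceIndex_mem p
  set t := twiceIndex N p
  rw [← sum_coeff_eq_simpsonSum hr,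
    ← Finset.sum_image (s := Finset.univ) (g := twiceIndex N)
      (f := fun k => coeff r (t - k).natAbs * v k) (twiceIndex_injective N).injOn,
    image_twiceIndex, ← Finset.sum_union]
  · have hinj : Set.InjOn (fun j : ℤ => t + j)
        (Finset.Icc (-((2 * r : ℕ) : ℤ)) ((2 * r : ℕ) : ℤ)) := (add_right_injective t).injOn
    have hsum := Finset.sum_image (f := fun k => coeff r (t - k).natAbs * v k) hinj
    simp only [sub_add_cancel_left, Int.natAbs_neg] at hsum
    rw [← hsum]
    symm
    apply Finset.sum_subset_zero_on_sdiff
    · intro k hk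
      simp only [Finset.mem_image, Finset.mem_Icc] at hk
      obtain ⟨j, hj, rfl⟩ := hk
      simp only [boundaryIndices, Finset.mem_union, Finset.mem_Icc]
      push_cast at hj
      omega
    · intro k hk
      have : 2 * r < (t - k).natAbs := by
        by_contra! hlt
        exact (Finset.mem_sdiff.1 hk).2 (Finset.mem_image.2 ⟨k - t, by
          rw [Finset.mem_Icc]; omega, by ring⟩)
      rw [coeff_eq_zero this, zero_mul]
    · exact fun _ _ => rfl
  · rw [Finset.disjoint_left]
    intro k hk hk'
    simp only [boundaryIndices, Finset.mem_union, Finset.mem_Icc] at hk hk'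
    omega

theorem eta_pos (N : ℕ) (δ : ℝ) : 0 < eta N δ := by
  have h1 := meshSize_pos N
  have h2 : (0 : ℝ) < ratio N δ := by exact_mod_cast one_le_ratio N δ
  unfold eta meshHorizon
  positivity

theorem stiffness_mulVec_add (N : ℕ) (δ : ℝ) (v : ℤ → ℝ) (p : Interior N) :
    (stiffness N δ).mulVec (fun q => v (twiceIndex N q)) p =
      eta N δ * ∑ k ∈ boundaryIndices N (ratio N δ),
        coeff (ratio N δ) (twiceIndex N p - k).natAbs * v k -
      discreteOp (meshSize N) (ratio N δ) v (twiceIndex N p) := by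
  rw [discreteOp, ← sum_interior_add_sum_boundary (one_le_ratio N δ)]
  change _ = _ - eta N δ * _
  simp only [Matrix.mulVec, dotProduct, stiffness_apply, neg_mul, Finset.sum_neg_distrib, mul_assoc,
    ← Finset.mul_sum]
  ring

/-! ### Stability -/

/-- The quadratic barrier `(x + δ̃)(1 + δ̃ - x) / 2` at the mesh points. -/
noncomputable def barrier (N r : ℕ) (k : ℤ) : ℝ :=
  (node N k + r * meshSize N) * (1 + r * meshSize N - node N k) / 2

theorem discreteOp_barrier {N r : ℕ} (hr : 1 ≤ r) (k : ℤ) :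
    discreteOp (meshSize N) r (barrier N r) k = -1 := by
  have hr0 : (0 : ℝ) < r := by exact_mod_cast hr
  have hh := meshSize_pos N
  rw [discreteOp]
  set h := meshSize N with hhd
  have hb : barrier N r = fun l : ℤ => barrier N r k +
      h / 4 * (1 - k * h) * ((l : ℝ) - k) + (-h ^ 2 / 8) * ((l : ℝ) - k) ^ 2 +
        0 * ((l : ℝ) - k) ^ 3 := by
    funext l
    simp only [barrier, node, ← hhd]
    ring
  have hs : simpsonSum r (barrier N r) k =
      12 * r * barrier N r k + 16 * (r : ℝ) ^ 3 * (-h ^ 2 / 8) := by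
    rw [hb, simpsonSum_cubic, ← hb]
  rw [hs]
  field_simp
  ring

/-- The reflection `k ↦ 2N + 2 - k` transfers estimates from the left end to the right end. -/
theorem node_add_node_reflect (N : ℕ) (k : ℤ) : node N k + node N (2 * N + 2 - k) = 1 := by
  rw [← meshSize_mul N, node, node]
  push_cast
  ring

theorem neg_le_node {N r : ℕ} {k : ℤ} (hk : -2 * (r : ℤ) + 1 ≤ k) :
    -(r * meshSize N) + meshSize N / 2 ≤ node N k := by
  have h : -2 * (r : ℝ) + 1 ≤ k := by exact_mod_cast hk
  have := mul_le_mul_of_nonneg_right h (meshSize_pos N).le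
  rw [node]
  linarith

theorem node_le {N r : ℕ} {k : ℤ} (hk : k ≤ 2 * (N : ℤ) + 2 * (r : ℤ) + 1) :
    node N k ≤ 1 + r * meshSize N - meshSize N / 2 := by
  have := neg_le_node (N := N) (r := r) (k := 2 * N + 2 - k) (by omega)
  linarith [node_add_node_reflect N k]

/-- The zeros `-δ̃` and `1 + δ̃` lie half a cell beyond the outermost boundary nodes. -/
theorem barrier_pos {N r : ℕ} {k : ℤ} (hk : -2 * (r : ℤ) + 1 ≤ k)
    (hk' : k ≤ 2 * (N : ℤ) + 2 * (r : ℤ) + 1) : 0 < barrier N r k := by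
  have h1 := neg_le_node (N := N) hk
  have h2 := node_le hk'
  have h3 := meshSize_pos N
  exact half_pos (mul_pos (by linarith) (by linarith))

theorem barrier_le (N r : ℕ) (k : ℤ) : barrier N r k ≤ (1 + r * meshSize N) ^ 2 := by
  have h : 0 ≤ r * meshSize N := mul_nonneg (Nat.cast_nonneg r) (meshSize_pos N).le
  rw [barrier]
  nlinarith [sq_nonneg (2 * node N k - 1)]

theorem abs_le_of_abs_stiffness_mulVec_le {N : ℕ} {δ T : ℝ} (hT : 0 ≤ T) {e : Interior N → ℝ}
    (he : ∀ p, |(stiffness N δ).mulVec e p| ≤ T) (p : Interior N) :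
    |e p| ≤ T * (1 + ratio N δ * meshSize N) ^ 2 := by
  have hη := eta_pos N δ
  have hr := one_le_ratio N δ
  refine (abs_le_of_abs_mulVec_le (A := stiffness N δ)
    (b := fun q => barrier N (ratio N δ) (twiceIndex N q)) ?_ ?_ ?_ hT he p).trans
    (mul_le_mul_of_nonneg_left (barrier_le _ _ _) hT)
  · intro p q hpq
    rw [stiffness_apply, neg_nonpos]
    refine mul_nonneg hη.le (coeff_nonneg _ ?_)
    have := (twiceIndex_injective N).ne hpq
    omega
  · intro q
    have := twiceIndex_mem q
    exact barrier_pos (by omega) (by omega)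
  · intro q
    rw [stiffness_mulVec_add, discreteOp_barrier hr, sub_neg_eq_add]
    -- The boundary part of the stencil, absent from the matrix, only increases `A b` above `1`.
    refine le_add_of_nonneg_left (mul_nonneg hη.le (Finset.sum_nonneg fun k hk => ?_))
    have hq := twiceIndex_mem q
    simp only [boundaryIndices, Finset.mem_union, Finset.mem_Icc] at hk
    exact mul_nonneg (coeff_nonneg _ (by omega)) (barrier_pos (by omega) (by omega)).le

theorem isUnit_det_stiffness (N : ℕ) (δ : ℝ) : IsUnit (stiffness N δ).det := by
  rw [← Matrix.isUnit_iff_isUnit_det, ← Matrix.mulVec_injective_iff_isUnit]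
  intro v w hvw
  have h0 : (stiffness N δ).mulVec (v - w) = 0 := by
    rw [Matrix.mulVec_sub, sub_eq_zero]
    exact hvw
  funext p
  have := abs_le_of_abs_stiffness_mulVec_le le_rfl (e := v - w)
    (fun p => by rw [h0]; simp) p
  rw [zero_mul] at this
  exact sub_eq_zero.1 (abs_nonpos_iff.1 this)

/-! ### Error bounds -/

/-- Interior nodes are at least `h / 2` from the ends of `(0, 1)`. This slack keeps all stencils
inside the interval where `u` is regular, even if `δ < h = δ̃`. -/
theorem meshHorizon_le_max (N : ℕ) (δ : ℝ) :
    ratio N δ * meshSize N ≤ max δ (meshSize N / 2) + meshSize N / 2 := by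
  have hh := meshSize_pos N
  rcases lt_or_ge δ (meshSize N) with h | h
  · rw [ratio_of_lt h]
    push_cast
    linarith [le_max_right δ (meshSize N / 2)]
  · linarith [le_max_left δ (meshSize N / 2), meshHorizon_le h]

theorem node_mem_constraintDomain {N : ℕ} {δ : ℝ} {k : ℤ}
    (hk : k ∈ boundaryIndices N (ratio N δ)) :
    node N k ∈ constraintDomain (max δ (meshSize N / 2)) := by
  have hh := meshSize_pos N
  have hR := meshHorizon_le_max N δ
  simp only [boundaryIndices, Finset.mem_union, Finset.mem_Icc] at hk
  rcases hk with ⟨h1, h2⟩ | ⟨h1, h2⟩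
  · refine Or.inl ⟨by linarith [neg_le_node (N := N) h1], ?_⟩
    have : (k : ℝ) ≤ 0 := by exact_mod_cast h2
    exact mul_nonpos_of_nonpos_of_nonneg (by linarith) hh.le
  · refine Or.inr ⟨?_, by linarith [node_le h2]⟩
    have h3 : node N (2 * N + 2 - k) ≤ 0 := by
      have : ((2 * N + 2 - k : ℤ) : ℝ) ≤ 0 := by exact_mod_cast (by omega : 2 * (N : ℤ) + 2 - k ≤ 0)
      exact mul_nonpos_of_nonpos_of_nonneg (by linarith) hh.le
    linarith [node_add_node_reflect N k]

theorem node_mem_Icc {N : ℕ} {k : ℤ} (hk : 1 ≤ k ∧ k ≤ 2 * (N : ℤ) + 1) :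
    node N k ∈ Set.Icc (meshSize N / 2) (1 - meshSize N / 2) := by
  have h1 := neg_le_node (N := N) (r := 0) (k := k) (by push_cast; omega)
  have h2 := node_le (N := N) (r := 0) (k := k) (by push_cast; omega)
  push_cast at h1 h2
  exact ⟨by linarith, by linarith⟩

/-- The error equation: the stiffness matrix maps the error to the truncation error. -/
theorem stiffness_mulVec_error {N : ℕ} {δ : ℝ} {f g u : ℝ → ℝ} (hu : SolvesNonlocal δ f g u)
    (hg : δ < meshSize N / 2 → ∀ x ∈ constraintDomain (meshSize N / 2), u x = g x)
    {U : Interior N → ℝ} (hU : (stiffness N δ).mulVec U = rhs N δ f g) (p : Interior N) :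
    (stiffness N δ).mulVec (fun q => U q - u (node N (twiceIndex N q))) p =
      discreteOp (meshSize N) (ratio N δ) (fun k => u (node N k)) (twiceIndex N p) -
        nonlocalOp δ u (node N (twiceIndex N p)) := by
  have hh := meshSize_pos N
  have hgu : ∀ x ∈ constraintDomain (max δ (meshSize N / 2)), u x = g x := by
    rcases lt_or_ge δ (meshSize N / 2) with h | h
    · rw [max_eq_right h.le]
      exact hg h
    · rw [max_eq_left h]
      exact hu.constraint
  have hx := node_mem_Icc (twiceIndex_mem p)
  have hsplit : (fun q => U q - u (node N (twiceIndex N q))) =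
      U - fun q => (fun k => u (node N k)) (twiceIndex N q) := rfl
  rw [hsplit, Matrix.mulVec_sub, Pi.sub_apply, hU,
    stiffness_mulVec_add N δ (fun k => u (node N k)), rhs,
    ← hu.equation _ ⟨by linarith [hx.1], by linarith [hx.2]⟩,
    Finset.sum_congr rfl fun k hk => by rw [← hgu _ (node_mem_constraintDomain hk)]]
  ring

section Truncation

variable {N : ℕ} {δ M : ℝ} {u : ℝ → ℝ} {k : ℤ}

theorem truncation_of_lt (hδ : 0 < δ) (hδh : δ < meshSize N) (hM : 0 ≤ M)
    (hu : ContDiffOn ℝ 4 u (Set.Icc (-max δ (meshSize N / 2)) (1 + max δ (meshSize N / 2))))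
    (hu4 : ∀ x ∈ Set.Icc (-max δ (meshSize N / 2)) (1 + max δ (meshSize N / 2)),
      |iteratedDerivWithin 4 u
        (Set.Icc (-max δ (meshSize N / 2)) (1 + max δ (meshSize N / 2))) x| ≤ M)
    (hk : 1 ≤ k ∧ k ≤ 2 * (N : ℤ) + 1) :
    |discreteOp (meshSize N) (ratio N δ) (fun l => u (node N l)) k - nonlocalOp δ u (node N k)| ≤
      12 * M * meshSize N ^ 2 := by
  have hh := meshSize_pos N
  obtain ⟨hx, hx'⟩ := node_mem_Icc hk
  have hR := le_max_left δ (meshSize N / 2)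
  have hRr := meshHorizon_le_max N δ
  obtain ⟨c₁, c₂, c₃, hc⟩ := exists_cubic_approx (by linarith) hM hu hu4 (x := node N k)
    ⟨by linarith, by linarith⟩
  have h1 := abs_nonlocalOp_sub_le hu.continuousOn hM hδ (by linarith) (by linarith) hc
  have h2 := abs_discreteOp_sub_le hM hh (one_le_ratio N δ) (k := k)
    (by change _ ≤ node N k - _; linarith) (by change node N k + _ ≤ _; linarith) hc
  change |discreteOp _ _ (fun l => u (node N l)) k - 2 * c₂| ≤ _ at h2
  rw [ratio_of_lt hδh, Nat.cast_one, one_mul] at h2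
  rw [ratio_of_lt hδh]
  have h3 : 6 * M * δ ^ 2 ≤ 6 * M * meshSize N ^ 2 := by gcongr
  have h4 := abs_le.1 h1
  have h5 := abs_le.1 h2
  exact abs_le.2 ⟨by linarith, by linarith⟩

theorem truncation_of_le (hδh : meshSize N ≤ δ) (hM : 0 ≤ M)
    (hu : ContDiffOn ℝ 4 u (Set.Icc (-max δ (meshSize N / 2)) (1 + max δ (meshSize N / 2))))
    (hu4 : ∀ x ∈ Set.Icc (-max δ (meshSize N / 2)) (1 + max δ (meshSize N / 2)),
      |iteratedDerivWithin 4 u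
        (Set.Icc (-max δ (meshSize N / 2)) (1 + max δ (meshSize N / 2))) x| ≤ M)
    (hk : 1 ≤ k ∧ k ≤ 2 * (N : ℤ) + 1) :
    |discreteOp (meshSize N) (ratio N δ) (fun l => u (node N l)) k - nonlocalOp δ u (node N k)| ≤
      M * (24 * ((δ - ratio N δ * meshSize N) * δ) + 48 * meshSize N ^ 4 / δ ^ 2) := by
  have hh := meshSize_pos N
  have hδ := hh.trans_le hδh
  obtain ⟨hx, hx'⟩ := node_mem_Icc hk
  have hR := le_max_left δ (meshSize N / 2)
  have hρ := meshHorizon_le hδh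
  have hρ' := lt_meshHorizon_add hδh
  have hr : (1 : ℝ) ≤ ratio N δ := by exact_mod_cast one_le_ratio N δ
  have hhρ : meshSize N ≤ ratio N δ * meshSize N := le_mul_of_one_le_left hh.le hr
  obtain ⟨c₁, c₂, c₃, hc⟩ := exists_cubic_approx (by linarith) hM hu hu4 (x := node N k)
    ⟨by linarith, by linarith⟩
  have h1 := abs_nonlocalOp_sub_nonlocalOp_le hu.continuousOn hM (hh.trans_le hhρ) hρ
    (by linarith) (by linarith) hc
  have h2 := abs_nonlocalOp_sub_discreteOp_le (by linarith) hM hu hu4 hh (one_le_ratio N δ) (k := k)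
    (by change _ ≤ node N k - _; linarith) (by change node N k + _ ≤ _; linarith)
  change |nonlocalOp _ u (node N k) - discreteOp _ _ (fun l => u (node N l)) k| ≤ _ at h2
  -- From `δ < δ̃ + h ≤ 2 δ̃`.
  have h3 : 12 * M * meshSize N ^ 4 / (ratio N δ * meshSize N) ^ 2 ≤
      12 * M * meshSize N ^ 4 / (δ / 2) ^ 2 := by
    have : δ / 2 ≤ ratio N δ * meshSize N := by linarith
    gcongr
  have h4 : 12 * M * meshSize N ^ 4 / (δ / 2) ^ 2 = M * (48 * meshSize N ^ 4 / δ ^ 2) := by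
    field_simp
    ring
  have h5 := abs_le.1 h1
  have h6 := abs_le.1 h2
  exact abs_le.2 ⟨by linarith, by linarith⟩

end Truncation

theorem norm_error_le {N : ℕ} {δ c T : ℝ} {f g u : ℝ → ℝ} (hT : 0 ≤ T)
    (hc : 0 ≤ c) (hδc : δ ≤ c) (hu : SolvesNonlocal δ f g u)
    (hg : δ < meshSize N / 2 → ∀ x ∈ constraintDomain (meshSize N / 2), u x = g x)
    {U : Interior N → ℝ} (hU : (stiffness N δ).mulVec U = rhs N δ f g)
    (h : ∀ k : ℤ, 1 ≤ k ∧ k ≤ 2 * (N : ℤ) + 1 →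
      |discreteOp (meshSize N) (ratio N δ) (fun l => u (node N l)) k -
        nonlocalOp δ u (node N k)| ≤ T) :
    ‖fun p => U p - u (node N (twiceIndex N p))‖ ≤ (2 + c) ^ 2 * T := by
  have hh := meshSize_pos N
  have hh1 := meshSize_le_one N
  have hρ : ratio N δ * meshSize N ≤ 1 + c := by
    rcases lt_or_ge δ (meshSize N) with h | h
    · rw [ratio_of_lt h]
      push_cast
      linarith
    · linarith [meshHorizon_le h]
  have hρ0 : 0 ≤ ratio N δ * meshSize N := mul_nonneg (Nat.cast_nonneg _) hh.le
  refine (pi_norm_le_iff_of_nonneg (by positivity)).2 fun p => ?_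
  refine (abs_le_of_abs_stiffness_mulVec_le (δ := δ) hT
    (e := fun q => U q - u (node N (twiceIndex N q))) (fun q => ?_) p).trans ?_
  · rw [stiffness_mulVec_error hu hg hU]
    exact h _ (twiceIndex_mem q)
  · rw [mul_comm]
    have : 1 + ratio N δ * meshSize N ≤ 2 + c := by linarith
    gcongr

end NonlocalCollocation

/-! ### Convergence rates. -/

open NonlocalCollocation
theorem theorem4p5 (β : ℝ) (hβ : 0 ≤ β) (c₁ c₂ : ℝ) (hc₁ : 0 < c₁) (hc₂ : 0 < c₂) (M : ℝ) :
    ∃ C : ℝ, 0 < C ∧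
      ∀ (N : ℕ) (δ : ℝ), c₁ * meshSize N ^ β ≤ δ → δ ≤ c₂ * meshSize N ^ β →
        IsUnit (stiffness N δ).det ∧
        ∀ (f g u : ℝ → ℝ),
          SolvesNonlocal δ f g u →
          -- if `δ < h/2`, the scheme also reads `g` at the boundary points `-h/2` and `1 + h/2`
          (δ < meshSize N / 2 → ∀ x ∈ constraintDomain (meshSize N / 2), u x = g x) →
          ContDiffOn ℝ 4 u
            (Set.Icc (-max δ (meshSize N / 2)) (1 + max δ (meshSize N / 2))) →
          (∀ x ∈ Set.Icc (-max δ (meshSize N / 2)) (1 + max δ (meshSize N / 2)),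
            |iteratedDerivWithin 4 u
              (Set.Icc (-max δ (meshSize N / 2)) (1 + max δ (meshSize N / 2))) x| ≤ M) →
          ∀ U : Interior N → ℝ, (stiffness N δ).mulVec U = rhs N δ f g →
            (¬ IsGridPoint N δ →
              ‖fun p => U p - u (node N (twiceIndex N p))‖
                ≤ C * meshSize N ^ min 2 (1 + β)) ∧
            (IsGridPoint N δ →
              ‖fun p => U p - u (node N (twiceIndex N p))‖
                ≤ C * meshSize N ^ max 2 (4 - 2 * β)) := by
  -- `12` serves `δ < h`, `48 + 24 * c₂` serves `δ ≥ h`, and `48 / c₁ ^ 2` the rate `4 - 2 * β`.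
  set L := 60 + 24 * c₂ + 48 / c₁ ^ 2 with hL
  have hL0 : 0 < L := by positivity
  refine ⟨(2 + c₂) ^ 2 * ((|M| + 1) * L), by positivity, fun N δ hδ₁ hδ₂ =>
    ⟨isUnit_det_stiffness N δ, fun f g u hu hg hreg hM4 U hU => ?_⟩⟩
  have hh := meshSize_pos N
  have hh1 := meshSize_le_one N
  have hδ : 0 < δ := lt_of_lt_of_le (mul_pos hc₁ (Real.rpow_pos_of_pos hh β)) hδ₁
  have hδc : δ ≤ c₂ :=
    hδ₂.trans (mul_le_of_le_one_right hc₂.le (Real.rpow_le_one hh.le hh1 hβ))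
  have hM4' := fun x hx => (hM4 x hx).trans (le_abs_self M)
  have hdiv : 0 < 48 / c₁ ^ 2 := by positivity
  -- it suffices to bound the truncation error
  have key : ∀ s : ℝ, (∀ k : ℤ, 1 ≤ k ∧ k ≤ 2 * (N : ℤ) + 1 →
      |discreteOp (meshSize N) (ratio N δ) (fun l => u (node N l)) k -
        nonlocalOp δ u (node N k)| ≤ |M| * (L * meshSize N ^ s)) →
      ‖fun p => U p - u (node N (twiceIndex N p))‖ ≤
        (2 + c₂) ^ 2 * ((|M| + 1) * L) * meshSize N ^ s := by
    intro s hs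
    have hpos := Real.rpow_pos_of_pos hh s
    refine (norm_error_le (by positivity) hc₂.le hδc hu hg hU hs).trans ?_
    rw [mul_assoc, mul_assoc]
    gcongr
    linarith
  refine ⟨fun _ => key _ fun k hk => ?_, fun hgrid => key _ fun k hk => ?_⟩
  · have hs2 : meshSize N ^ 2 ≤ meshSize N ^ min 2 (1 + β) := by
      rw [← Real.rpow_two]
      exact Real.rpow_le_rpow_of_exponent_ge hh hh1 (min_le_left _ _)
    have hsβ : meshSize N ^ (1 + β) ≤ meshSize N ^ min 2 (1 + β) :=
      Real.rpow_le_rpow_of_exponent_ge hh hh1 (min_le_right _ _)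
    have hpos := Real.rpow_pos_of_pos hh (min 2 (1 + β))
    set P := meshSize N ^ min 2 (1 + β)
    rcases lt_or_ge δ (meshSize N) with h | h
    · refine (truncation_of_lt hδ h (abs_nonneg M) hreg hM4' hk).trans ?_
      rw [mul_comm (12 : ℝ), mul_assoc]
      refine mul_le_mul_of_nonneg_left ?_ (abs_nonneg M)
      have : 12 * P ≤ L * P := mul_le_mul_of_nonneg_right (by linarith) hpos.le
      linarith
    · refine (truncation_of_le h (abs_nonneg M) hreg hM4' hk).trans ?_
      refine mul_le_mul_of_nonneg_left ?_ (abs_nonneg M)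
      have h1 : (δ - ratio N δ * meshSize N) * δ ≤ c₂ * P := by
        have hlt := lt_meshHorizon_add h
        calc (δ - ratio N δ * meshSize N) * δ ≤ meshSize N * (c₂ * meshSize N ^ β) :=
              mul_le_mul (by linarith) hδ₂ hδ.le hh.le
          _ = c₂ * meshSize N ^ (1 + β) := by rw [Real.rpow_add hh, Real.rpow_one]; ring
          _ ≤ c₂ * P := by gcongr
      have h2 : 48 * meshSize N ^ 4 / δ ^ 2 ≤ 48 * P := by
        calc 48 * meshSize N ^ 4 / δ ^ 2 ≤ 48 * meshSize N ^ 4 / meshSize N ^ 2 := by gcongr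
          _ = 48 * meshSize N ^ 2 := by field_simp
          _ ≤ 48 * P := by gcongr
      have : (48 + 24 * c₂) * P ≤ L * P := mul_le_mul_of_nonneg_right (by linarith) hpos.le
      linarith
  · obtain ⟨h, hρ⟩ := hgrid.meshHorizon_eq hδ
    refine (truncation_of_le h (abs_nonneg M) hreg hM4' hk).trans ?_
    refine mul_le_mul_of_nonneg_left ?_ (abs_nonneg M)
    rw [hρ, sub_self, zero_mul, mul_zero, zero_add]
    -- Both lower bounds `δ ≥ h` and `δ ≥ c₁ h^β` are available in `h⁴ / δ²`; the larger exponent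
    -- decides which one is used.
    rcases max_choice (2 : ℝ) (4 - 2 * β) with hm | hm <;> rw [hm]
    · rw [Real.rpow_two]
      calc 48 * meshSize N ^ 4 / δ ^ 2 ≤ 48 * meshSize N ^ 4 / meshSize N ^ 2 := by gcongr
        _ = 48 * meshSize N ^ 2 := by field_simp
        _ ≤ L * meshSize N ^ 2 := by gcongr; linarith
    · have hpos := Real.rpow_pos_of_pos hh β
      have hsplit : meshSize N ^ (4 - 2 * β) = meshSize N ^ 4 / (meshSize N ^ β) ^ 2 := by
        rw [Real.rpow_sub hh, mul_comm 2 β, Real.rpow_mul hh.le, Real.rpow_two]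
        norm_cast
      rw [hsplit]
      calc 48 * meshSize N ^ 4 / δ ^ 2 ≤
            48 * meshSize N ^ 4 / (c₁ * meshSize N ^ β) ^ 2 := by gcongr
        _ = 48 / c₁ ^ 2 * (meshSize N ^ 4 / (meshSize N ^ β) ^ 2) := by field_simp
        _ ≤ L * (meshSize N ^ 4 / (meshSize N ^ β) ^ 2) := by gcongr; linarith
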